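/- Let $\mathbb{B}^3$ be the closed unit ball of $\mathbb{E}^3$ centred at the origin. A unit vector $u$ illuminates a point $p$ of the boundary of a convex body $K$ if $p+\lambda u\in\operatorname{int}K$ for some $\lambda>0$. A finite multiset $U$ of unit vectors $m$-fold illuminates $K$ if each boundary point of $K$ is illuminated by at least $m$ members of $U$, counted with multiplicity, and $I^m(K)$ denotes the smallest number of elements, counted with multiplicity, of such a multiset. If $V$ is a countable set of points outside $K$ such that the segment joining any two distinct points of $V$ meets $K$, then $\widehat K(V)=\bigcup_{v\in V}\operatorname{conv}(K\cup\{v\})$ is called the cap body of $K$ with respect to $V$. Let $m\ge 1$ and $n\ge 3$ be integers, and let $V=\{q_1,\dots,q_n,q_{n+1},q_{n+2}\}$, where $$q_i=\left(\sec\frac{\pi}{n}\cos\frac{2i\pi}{n},\ \sec\frac{\pi}{n}\sin\frac{2i\pi}{n},\ 0\right)\qquad(i=1,\dots,n)$$ and $$q_{n+1}=\left(0,0,\sec\frac{(n-2)\pi}{2n}\right),\qquad q_{n+2}=\left(0,0,-\sec\frac{(n-2)\pi}{2n}\right).$$ Then $\widehat{\mathbb{B}^3}(V)$ is a cap body of $\mathbb{B}^3$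 with respect to $V$, and $$I^m\left(\widehat{\mathbb{B}^3}(V)\right)=2m+\left\lceil\frac{mn}{\left\lfloor\frac{n-1}{2}\right\rfloor}\right\rceil.$$ -/

import Mathlib

/-- The direction `u` illuminates the point `p` with respect to `K`: some point `p + t • u`
with `t > 0` lies in the interior of `K`. -/
def Illuminates {E : Type*} [NormedAddCommGroup E] [NormedSpace ℝ E]
    (K : Set E) (u : Metric.sphere (0 : E) 1) (p : E) : Prop :=
  ∃ t : ℝ, 0 < t ∧ p + t • (u : E) ∈ interior K

open Classical in
/-- `K` is `m`-fold illuminated by the multiset `U` of unit vectors: each boundary point of `K` is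
illuminated by at least `m` members of `U`, counted with multiplicity. -/
def IsMultiIlluminated {E : Type*} [NormedAddCommGroup E] [NormedSpace ℝ E]
    (m : ℕ) (K : Set E) (U : Multiset (Metric.sphere (0 : E) 1)) : Prop :=
  ∀ p ∈ frontier K, m ≤ U.countP (fun u => Illuminates K u p)

/-- The `m`-fold illumination number of `K`: the least cardinality (with multiplicity) of a multiset
of directions that illuminates `K` `m`-fold; its value is `⊤` if there is no such multiset. -/
noncomputable def illuminationNumber {E : Type*} [NormedAddCommGroup E] [NormedSpace ℝ E]
    (m : ℕ) (K : Set E) : ℕ∞ :=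
  ⨅ (U : Multiset (Metric.sphere (0 : E) 1)) (_ : IsMultiIlluminated m K U), (U.card : ℕ∞)

/-- The union of the convex hulls of `K ∪ {v}` over the points `v` of `V`. -/
def spikyBody {E : Type*} [NormedAddCommGroup E] [NormedSpace ℝ E] (K V : Set E) : Set E :=
  ⋃ v ∈ V, convexHull ℝ (K ∪ {v})

/-- `C` is the cap body of `K` with respect to `V`: the set `V` is countable and disjoint from `K`,
the segment between any two distinct points of `V` meets `K`, and `C` is the union of the convex
hulls of `K ∪ {v}` for `v ∈ V`. -/
def IsCapBody {E : Type*} [NormedAddCommGroup E] [NormedSpace ℝ E] (K V C : Set E) : Prop :=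
  V.Countable ∧ Disjoint V K ∧
    (∀ v ∈ V, ∀ w ∈ V, v ≠ w → (segment ℝ v w ∩ K).Nonempty) ∧ C = spikyBody K V

/-- The secant function. -/
noncomputable def secant (x : ℝ) : ℝ := 1 / Real.cos x

/-- The `i`-th vertex of the regular `n`-gon circumscribed about the equator of the unit ball. -/
noncomputable def equatorialVertex (n i : ℕ) : EuclideanSpace ℝ (Fin 3) :=
  !₂[secant (Real.pi / n) * Real.cos (2 * i * Real.pi / n),
     secant (Real.pi / n) * Real.sin (2 * i * Real.pi / n), 0]

/-- The `n` equatorial vertices together with the two poles. -/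
noncomputable def bipyramidVertices (n : ℕ) : Set (EuclideanSpace ℝ (Fin 3)) :=
  equatorialVertex n '' Set.Icc 1 n ∪
    {!₂[0, 0, secant (((n : ℝ) - 2) * Real.pi / (2 * n))],
     !₂[0, 0, -secant (((n : ℝ) - 2) * Real.pi / (2 * n))]}

/-! Write `k` for `(n - 1) / 2`. A direction `u` illuminates a vertex `v` exactly when `-⟪u, v⟫ >
√(‖v‖ ^ 2 - 1)`: the cap body lies in the tangent cone at `v` (necessity,
`IsCapBody.lt_neg_inner_of_illuminates`), and under this condition the ray from `v` enters the open
ball (sufficiency, `illuminates_of_inner_neg`).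

Lower bound: only the vertices matter. A direction lighting a pole lights no other vertex, and any
direction lights at most `k` equatorial vertices (`card_filter_sin_lt_le`). Giving each pole weight
`k` and each equatorial vertex weight `1`, every direction lights total weight at most `k`, so `2 *
k * m + n * m ≤ k * U.card`.

Upper bound: take `m` copies of each polar direction and `N = ⌈m * n / k⌉` equatorial ones, aimed
against the midpoints of `N` successive blocks of `k` vertices wound around the polygon. Each vertex
lies in at least `m` blocks (`le_card_filter_exists_mem_Icc`). The same directions light the sphere,
and points of a spike inherit the illumination of its apex. -/

/-- The closed cone with apex `v` spanned by the unit ball, for `v` outside the ball. -/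
def tangentCone {E : Type*} [NormedAddCommGroup E] [InnerProductSpace ℝ E] (v : E) : Set E :=
  {x | √(‖v‖ ^ 2 - 1) * ‖x - v‖ ≤ inner ℝ (v - x) v}

lemma Multiset.countP_le_countP_of_imp {α : Type*} {p q : α → Prop} [DecidablePred p]
    [DecidablePred q] (s : Multiset α) (h : ∀ a, p a → q a) : s.countP p ≤ s.countP q := by
  rw [Multiset.countP_eq_card_filter, Multiset.countP_eq_card_filter]
  exact Multiset.card_le_card (Multiset.monotone_filter_right s fun a => h a)

/-! ### Tangent cones and illumination of cap bodies of a ball -/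

section InnerProductSpace

variable {E : Type*} [NormedAddCommGroup E] [InnerProductSpace ℝ E]

lemma convex_tangentCone (v : E) : Convex ℝ (tangentCone v) := by
  intro x hx y hy a b ha hb hab
  simp only [tangentCone, Set.mem_ofPred_eq] at *
  have h1 : a • x + b • y - v = a • (x - v) + b • (y - v) := by
    obtain rfl : a = 1 - b := by linarith
    module
  have h2 : v - (a • x + b • y) = a • (v - x) + b • (v - y) := by
    obtain rfl : a = 1 - b := by linarith
    module
  have h3 : ‖a • (x - v) + b • (y - v)‖ ≤ a * ‖x - v‖ + b * ‖y - v‖ := by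
    refine (norm_add_le _ _).trans_eq ?_
    rw [norm_smul, norm_smul, Real.norm_of_nonneg ha, Real.norm_of_nonneg hb]
  rw [h1, h2, inner_add_left, real_inner_smul_left, real_inner_smul_left]
  calc _ ≤ √(‖v‖ ^ 2 - 1) * (a * ‖x - v‖ + b * ‖y - v‖) := by gcongr
    _ = a * (√(‖v‖ ^ 2 - 1) * ‖x - v‖) + b * (√(‖v‖ ^ 2 - 1) * ‖y - v‖) := by ring
    _ ≤ _ := by gcongr

lemma closedBall_subset_tangentCone {v : E} (hv : 1 < ‖v‖) :
    Metric.closedBall 0 1 ⊆ tangentCone v := by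
  intro b hb
  have hb1 : ‖b‖ ≤ 1 := by simpa using hb
  have hin : inner ℝ b v ≤ ‖v‖ :=
    (real_inner_le_norm b v).trans (by nlinarith [norm_nonneg v])
  have hb2 : ‖b‖ ^ 2 ≤ 1 := by nlinarith [norm_nonneg b]
  change √(‖v‖ ^ 2 - 1) * ‖b - v‖ ≤ inner ℝ (v - b) v
  have hV : 0 ≤ ‖v‖ ^ 2 - 1 := by nlinarith
  rw [inner_sub_left, real_inner_self_eq_norm_sq]
  refine abs_le_of_sq_le_sq' ?_ (by nlinarith) |>.2
  rw [mul_pow, Real.sq_sqrt hV, norm_sub_sq_real]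
  -- With `‖b‖ ≤ 1`, the difference of the squared sides is at least `(⟪b, v⟫ - 1) ^ 2`.
  nlinarith [sq_nonneg (inner ℝ b v - 1), mul_le_mul_of_nonneg_left hb2 hV]

/-- The cone is invariant under positive scaling about `v`, and `w` lies on the ray from `v` through
a point of the ball. -/
lemma mem_tangentCone_of_segment {v w : E} (hv : 1 < ‖v‖)
    (h : (segment ℝ v w ∩ Metric.closedBall 0 1).Nonempty) : w ∈ tangentCone v := by
  obtain ⟨b, hs, hb⟩ := h
  rw [segment_eq_image'] at hs
  obtain ⟨t, ⟨ht0, -⟩, rfl⟩ := hs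
  have hmem := closedBall_subset_tangentCone hv hb
  have ht : 0 < t := by
    rcases ht0.eq_or_lt with rfl | h
    · simp at hb; linarith
    · exact h
  simp only [tangentCone, Set.mem_ofPred_eq] at hmem ⊢
  have e1 : v + t • (w - v) - v = t • (w - v) := by module
  have e2 : v - (v + t • (w - v)) = t • (v - w) := by module
  rw [e1, e2, norm_smul, real_inner_smul_left, Real.norm_of_nonneg ht0] at hmem
  refine le_of_mul_le_mul_left ?_ ht
  linarith

lemma self_mem_tangentCone (v : E) : v ∈ tangentCone v := by simp [tangentCone]

lemma IsCapBody.subset_tangentCone {V C : Set E} (h : IsCapBody (Metric.closedBall 0 1) V C)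
    {v : E} (hv : v ∈ V) : C ⊆ tangentCone v := by
  obtain ⟨-, hd, hs, rfl⟩ := h
  have hv1 : 1 < ‖v‖ := by simpa using Set.disjoint_left.1 hd hv
  refine Set.iUnion₂_subset fun w hw => convexHull_min ?_ (convex_tangentCone v)
  rw [Set.union_singleton, Set.insert_subset_iff]
  refine ⟨?_, closedBall_subset_tangentCone hv1⟩
  by_cases hvw : v = w
  · exact hvw ▸ self_mem_tangentCone v
  · exact mem_tangentCone_of_segment hv1 (hs v hv w hw hvw)

lemma exists_add_smul_mem_of_mem_interior {S : Set E} {x : E} (hx : x ∈ interior S) (v : E) :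
    ∃ ε : ℝ, 0 < ε ∧ x + ε • v ∈ S := by
  have hc : Filter.Tendsto (fun ε : ℝ => x + ε • v) (nhdsWithin 0 (Set.Ioi 0)) (nhds x) := by
    have : Continuous fun ε : ℝ => x + ε • v := by fun_prop
    simpa using (this.tendsto 0).mono_left nhdsWithin_le_nhds
  obtain ⟨ε, h1, h2⟩ := ((hc.eventually (mem_interior_iff_mem_nhds.1 hx)).and
    self_mem_nhdsWithin).exists
  exact ⟨ε, h2, h1⟩

/-- Moving `x` by `ε • v` costs `ε * ‖v‖ ^ 2` on the right but changes the left by at most `√(‖v‖ ^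
2 - 1) * ε * ‖v‖`, which is smaller; the slack gives strictness. -/
lemma lt_inner_of_mem_interior_tangentCone {v x : E} (hv : 1 < ‖v‖)
    (hx : x ∈ interior (tangentCone v)) : √(‖v‖ ^ 2 - 1) * ‖x - v‖ < inner ℝ (v - x) v := by
  obtain ⟨ε, hε, h⟩ := exists_add_smul_mem_of_mem_interior hx v
  have hs : √(‖v‖ ^ 2 - 1) < ‖v‖ := by
    rw [Real.sqrt_lt' (by linarith)]; linarith
  simp only [tangentCone, Set.mem_ofPred_eq] at h
  have e2 : v - (x + ε • v) = (v - x) - ε • v := by module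
  have e3 : ‖x - v‖ ≤ ‖x + ε • v - v‖ + ε * ‖v‖ := by
    have := norm_sub_le (x + ε • v - v) (ε • v)
    rw [norm_smul, Real.norm_of_nonneg hε.le, add_sub_right_comm, add_sub_cancel_right] at this
    rwa [add_sub_right_comm]
  rw [e2, inner_sub_left, real_inner_smul_left, real_inner_self_eq_norm_sq] at h
  have h4 := mul_le_mul_of_nonneg_left e3 (Real.sqrt_nonneg (‖v‖ ^ 2 - 1))
  have h5 : √(‖v‖ ^ 2 - 1) * (ε * ‖v‖) < ‖v‖ * (ε * ‖v‖) := by gcongr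
  nlinarith

lemma subset_spikyBody {K V : Set E} (hV : V.Nonempty) : K ⊆ spikyBody K V := by
  obtain ⟨v, hv⟩ := hV
  exact (Set.subset_union_left.trans (subset_convexHull ℝ _)).trans
    (Set.subset_biUnion_of_mem (u := fun v => convexHull ℝ (K ∪ {v})) hv)

lemma IsCapBody.mem_frontier {V C : Set E} (h : IsCapBody (Metric.closedBall 0 1) V C)
    {v : E} (hv : v ∈ V) : v ∈ frontier C := by
  have hv1 : 1 < ‖v‖ := by simpa using Set.disjoint_left.1 h.2.1 hv
  refine ⟨subset_closure ?_, fun hi => ?_⟩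
  · rw [h.2.2.2]
    exact Set.mem_biUnion hv (subset_convexHull ℝ _ (by simp))
  · have := lt_inner_of_mem_interior_tangentCone hv1
      (interior_mono (h.subset_tangentCone hv) hi)
    simp at this

lemma IsCapBody.lt_neg_inner_of_illuminates {V C : Set E}
    (h : IsCapBody (Metric.closedBall 0 1) V C) {v : E} (hv : v ∈ V)
    {u : Metric.sphere (0 : E) 1} (hu : Illuminates C u v) :
    √(‖v‖ ^ 2 - 1) < -inner ℝ (u : E) v := by
  have hv1 : 1 < ‖v‖ := by simpa using Set.disjoint_left.1 h.2.1 hv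
  obtain ⟨t, ht, hi⟩ := hu
  have := lt_inner_of_mem_interior_tangentCone hv1
      (interior_mono (h.subset_tangentCone hv) hi)
  have hu1 : ‖(u : E)‖ = 1 := by simp
  rw [add_sub_cancel_left, sub_add_cancel_left, norm_smul, hu1, Real.norm_of_nonneg ht.le,
    inner_neg_left, real_inner_smul_left] at this
  refine lt_of_mul_lt_mul_left ?_ ht.le
  linarith

lemma illuminates_of_inner_neg {C : Set E} (hC : Metric.closedBall 0 1 ⊆ C) {v b : E}
    (hb : ‖b‖ ≤ 1) {u : Metric.sphere (0 : E) 1} (hu : inner ℝ (u : E) v < 0)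
    (hu' : ‖v‖ ^ 2 - 1 < inner ℝ (u : E) v ^ 2) {s : ℝ} (hs : 0 < s) (hs1 : s ≤ 1) :
    Illuminates C u ((1 - s) • b + s • v) := by
  -- This `t` reaches the point of the line `v + ℝ u` nearest the origin, whose squared norm is `‖v‖
  -- ^ 2 - ⟪u, v⟫ ^ 2 < 1`.
  set t := -inner ℝ (u : E) v with ht
  refine ⟨s * t, mul_pos hs (by linarith), ?_⟩
  refine interior_mono hC (interior_mono Metric.ball_subset_closedBall ?_)
  rw [Metric.isOpen_ball.interior_eq, mem_ball_zero_iff]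
  have hu1 : ‖(u : E)‖ = 1 := by simp
  have h1 : ‖v + t • (u : E)‖ < 1 := by
    have : ‖v + t • (u : E)‖ ^ 2 < 1 := by
      rw [norm_add_sq_real, norm_smul, hu1, real_inner_smul_right, real_inner_comm,
        mul_one, Real.norm_eq_abs, sq_abs]
      nlinarith
    nlinarith [norm_nonneg (v + t • (u : E))]
  have e : (1 - s) • b + s • v + (s * t) • (u : E) = (1 - s) • b + s • (v + t • (u : E)) := by
    module
  rw [e]
  refine (norm_add_le _ _).trans_lt ?_
  rw [norm_smul, norm_smul, Real.norm_of_nonneg hs.le, Real.norm_of_nonneg (by linarith)]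
  nlinarith

lemma convexHull_closedBall_union_singleton (v : E) :
    convexHull ℝ (Metric.closedBall (0 : E) 1 ∪ {v}) =
      (fun q : ℝ × E => (1 - q.1) • q.2 + q.1 • v) '' Set.Icc 0 1 ×ˢ Metric.closedBall 0 1 := by
  rw [Set.union_singleton, convexHull_insert ⟨0, by simp⟩,
    (convex_closedBall (0 : E) 1).convexHull_eq, convexJoin_singleton_left]
  ext x
  simp only [segment_symm ℝ v, segment_eq_image, Set.mem_iUnion, Set.mem_image, Prod.exists,
    Set.mem_prod]
  constructor
  · rintro ⟨b, hb, s, hs, rfl⟩; exact ⟨s, b, ⟨hs, hb⟩, rfl⟩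
  · rintro ⟨s, b, ⟨hs, hb⟩, rfl⟩; exact ⟨b, hb, s, hs, rfl⟩

lemma isClosed_spikyBody_closedBall [FiniteDimensional ℝ E] {V : Set E} (hV : V.Finite) :
    IsClosed (spikyBody (Metric.closedBall (0 : E) 1) V) := by
  have := FiniteDimensional.proper ℝ E
  refine hV.isClosed_biUnion fun v _ => ?_
  rw [convexHull_closedBall_union_singleton]
  refine ((isCompact_Icc.prod (isCompact_closedBall 0 1)).image ?_).isClosed
  fun_prop

open Classical in
lemma isMultiIlluminated_spikyBody_closedBall [FiniteDimensional ℝ E] {V : Set E} (hV : V.Finite)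
    (hne : V.Nonempty) {m : ℕ} {U : Multiset (Metric.sphere (0 : E) 1)}
    (hball : ∀ p : E, ‖p‖ = 1 → m ≤ U.countP (fun u : Metric.sphere (0 : E) 1 => inner ℝ (u : E) p < 0))
    (hvert : ∀ v ∈ V, m ≤ U.countP
      (fun u : Metric.sphere (0 : E) 1 => inner ℝ (u : E) v < 0 ∧
        ‖v‖ ^ 2 - 1 < inner ℝ (u : E) v ^ 2)) :
    IsMultiIlluminated m (spikyBody (Metric.closedBall 0 1) V) U := by
  intro p hp
  have hC := subset_spikyBody (K := Metric.closedBall (0 : E) 1) hne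
  have hpK : p ∈ spikyBody (Metric.closedBall 0 1) V := by
    simpa [(isClosed_spikyBody_closedBall hV).closure_eq] using hp.1
  obtain ⟨v, hv, hpv⟩ := Set.mem_iUnion₂.1 hpK
  rw [convexHull_closedBall_union_singleton] at hpv
  obtain ⟨⟨s, b⟩, ⟨⟨hs0, hs1⟩, hb⟩, rfl⟩ := hpv
  have hb1 : ‖b‖ ≤ 1 := by simpa using hb
  simp only at *
  rcases hs0.eq_or_lt with rfl | hs
  · simp only [sub_zero, one_smul, zero_smul, add_zero] at *
    have hb2 : ‖b‖ = 1 := by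
      refine hb1.antisymm (not_lt.1 fun hlt => hp.2 (interior_mono hC
        (interior_mono Metric.ball_subset_closedBall ?_)))
      rw [Metric.isOpen_ball.interior_eq]
      simpa using hlt
    refine (hball b hb2).trans ?_
    refine Multiset.countP_le_countP_of_imp U fun u hu => ?_
    have := illuminates_of_inner_neg hC (u := u) hb1 hu (by rw [hb2]; nlinarith) one_pos le_rfl
    simpa using this
  · exact (hvert v hv).trans (Multiset.countP_le_countP_of_imp U fun u hu =>
      illuminates_of_inner_neg hC hb1 hu.1 hu.2 hs hs1)

end InnerProductSpace

/-! ### Counting vertices of a regular polygon by angle -/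

open Real in
lemma exists_int_abs_sub_lt_of_cos_lt_cos {β θ : ℝ} (hβ : 0 ≤ β) (h : cos β < cos θ) :
    ∃ k : ℤ, |θ - 2 * π * k| < β := by
  have hp : 0 < 2 * π := by positivity
  refine ⟨toIocDiv hp (-π) θ, ?_⟩
  have h1 := toIocMod_mem_Ioc hp (-π) θ
  have h2 : θ - 2 * π * (toIocDiv hp (-π) θ : ℤ) = toIocMod hp (-π) θ := by
    rw [toIocMod, zsmul_eq_mul]; ring
  have h3 : cos θ = cos |θ - 2 * π * (toIocDiv hp (-π) θ : ℤ)| := by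
    rw [cos_abs, mul_comm, cos_sub_int_mul_two_pi]
  rw [h3] at h
  by_contra! hle
  refine h.not_ge (cos_le_cos_of_nonneg_of_le_pi hβ ?_ hle)
  rw [h2, abs_le]
  exact ⟨h1.1.le, by linarith [h1.2]⟩

open Real in
lemma cos_lt_cos_of_abs_sub_lt {β θ : ℝ} (hβ : β ≤ π) {k : ℤ} (h : |θ - 2 * π * k| < β) :
    cos β < cos θ := by
  rw [← cos_sub_int_mul_two_pi θ k, ← cos_abs (θ - _), mul_comm (k : ℝ)]
  exact cos_lt_cos_of_nonneg_of_le_pi (abs_nonneg _) hβ h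

-- In units of the vertex spacing, the lit vertices have lifts in an open interval of length `(n -
-- 2) / 2`, which contains at most `(n - 1) / 2` integers.
open Real in
lemma card_filter_sin_lt_le {n : ℕ} (hn : 3 ≤ n) {x y : ℝ} (hxy : x ^ 2 + y ^ 2 ≤ 1) :
    ((Finset.Icc 1 n).filter fun i : ℕ =>
      sin (π / n) < x * cos (2 * i * π / n) + y * sin (2 * i * π / n)).card ≤ (n - 1) / 2 := by
  have hn' : (3 : ℝ) ≤ n := by exact_mod_cast hn
  have hπ := pi_pos
  have hα0 : 0 < π / n := by positivity
  have hα : π / n ≤ π / 3 := by gcongr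
  have hsin : 0 < sin (π / n) := sin_pos_of_pos_of_lt_pi hα0 (by linarith)
  set φ := Complex.arg ⟨x, y⟩
  set ρ := ‖(⟨x, y⟩ : ℂ)‖
  have hx : ρ * cos φ = x := Complex.norm_mul_cos_arg ⟨x, y⟩
  have hy : ρ * sin φ = y := Complex.norm_mul_sin_arg ⟨x, y⟩
  have hρ0 : 0 ≤ ρ := norm_nonneg _
  have hρ1 : ρ ≤ 1 := by
    have : ρ ^ 2 = x ^ 2 + y ^ 2 := by
      rw [← hx, ← hy]; linear_combination ρ ^ 2 * (-(sin_sq_add_cos_sq φ))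
    nlinarith
  have key : ∀ i : ℕ, sin (π / n) < x * cos (2 * i * π / n) + y * sin (2 * i * π / n) →
      ∃ j : ℤ, |(j : ℝ) - φ * n / (2 * π)| < (n - 2) / 4 ∧ (n : ℤ) ∣ i - j := by
    intro i hi
    have e : x * cos (2 * i * π / n) + y * sin (2 * i * π / n) =
        ρ * cos (2 * i * π / n - φ) := by
      rw [← hx, ← hy, cos_sub]; ring
    rw [e] at hi
    have hc : 0 < cos (2 * i * π / n - φ) := by
      by_contra! h
      nlinarith
    have : cos (π / 2 - π / n) < cos (2 * i * π / n - φ) := by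
      rw [cos_pi_div_two_sub]; nlinarith
    obtain ⟨k, hk⟩ := exists_int_abs_sub_lt_of_cos_lt_cos (by linarith) this
    refine ⟨i - n * k, ?_, ⟨k, by ring⟩⟩
    have e2 : ((i - n * k : ℤ) : ℝ) - φ * n / (2 * π) =
        (2 * i * π / n - φ - 2 * π * k) * (n / (2 * π)) := by
      push_cast; field_simp; ring
    have e3 : ((n : ℝ) - 2) / 4 = (π / 2 - π / n) * (n / (2 * π)) := by field_simp; ring
    rw [e2, e3, abs_mul, abs_of_pos (by positivity : (0 : ℝ) < n / (2 * π))]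
    gcongr
  choose! f hf hfd using key
  set c := φ * n / (2 * π)
  -- The least integer strictly above the left end of the open interval.
  set j₀ := ⌊c - (n - 2) / 4⌋ + 1 with hj₀
  have hcard : (Finset.Ico j₀ (j₀ + ((n - 1) / 2 : ℕ))).card = (n - 1) / 2 := by
    rw [Int.card_Ico]; omega
  rw [← hcard]
  refine Finset.card_le_card_of_injOn f ?_ ?_
  · intro i hi
    have h := abs_lt.1 (hf i (Finset.mem_filter.1 hi).2)
    have h1 : j₀ ≤ f i := by
      rw [hj₀, Int.add_one_le_iff, Int.floor_lt]; linarith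
    have h2 : c - (n - 2) / 4 < j₀ := by
      rw [hj₀]; push_cast; exact Int.lt_floor_add_one _
    have h3 : 2 * (f i - j₀) < n - 2 := by
      have : (2 : ℝ) * (f i - j₀) < n - 2 := by linarith
      exact_mod_cast this
    simp only [Finset.coe_Ico, Set.mem_Ico]
    omega
  · intro i hi i' hi' hii
    simp only [Finset.coe_filter, Finset.mem_Icc, Set.mem_ofPred_eq] at hi hi'
    have h1 := dvd_sub (hfd i hi.2) (hfd i' hi'.2)
    rw [hii, sub_sub_sub_cancel_right] at h1
    have := Int.eq_zero_of_abs_lt_dvd h1 (by rw [abs_lt]; omega)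
    omega

-- The lifts `a + t * n`, `t < m`, of the residue `a` of `i` lie in `[0, m * n)`, which the `N`
-- blocks of length `k` cover. As `k ≤ n`, different lifts fall in different blocks.
open Classical in
lemma le_card_filter_exists_mem_Icc {m n k N : ℕ} (hk : 0 < k) (hkn : k ≤ n)
    (hN : m * n ≤ N * k) (i : ℤ) :
    m ≤ ((Finset.range N).filter fun j : ℕ =>
      ∃ t : ℤ, i + t * n ∈ Set.Icc (j * k : ℤ) (j * k + k - 1)).card := by
  have hn : (0 : ℤ) < n := by omega
  obtain ⟨a, ha⟩ := Int.eq_ofNat_of_zero_le (Int.emod_nonneg i hn.ne')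
  have han : a < n := by have := Int.emod_lt_of_pos i hn; omega
  have hmono : StrictMono fun t : ℕ => (a + t * n) / k := by
    refine strictMono_nat_of_lt_succ fun t => ?_
    calc (a + t * n) / k < (a + t * n) / k + 1 := Nat.lt_succ_self _
      _ = (a + t * n + k) / k := (Nat.add_div_right _ hk).symm
      _ ≤ _ := Nat.div_le_div_right (by linarith)
  conv_lhs => rw [← Finset.card_range m]
  refine Finset.card_le_card_of_injOn _ (fun t ht => ?_) (hmono.injective.injOn)
  have htm : t < m := by simpa using ht
  simp only [Finset.coe_filter, Finset.mem_range, Set.mem_ofPred_eq]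
  refine ⟨?_, t - i / n, ?_⟩
  · rw [Nat.div_lt_iff_lt_mul hk]
    calc a + t * n < (t + 1) * n := by linarith
      _ ≤ m * n := Nat.mul_le_mul_right _ htm
      _ ≤ _ := hN
  · have e : i + (t - i / n) * n = ((a + t * n : ℕ) : ℤ) := by
      have := Int.emod_add_mul_ediv i n
      push_cast
      linarith
    have h1 := Nat.div_add_mod (a + t * n) k
    have h2 := Nat.mod_lt (a + t * n) hk
    rw [e]
    have h3 : (((a + t * n) / k : ℕ) : ℤ) * k + ((a + t * n) % k : ℕ) = (a + t * n : ℕ) := by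
      rw [mul_comm]; exact_mod_cast h1
    constructor <;> omega

open Real in
/-- The direction bisecting the `j`-th block of `k` consecutive vertices of the `n`-gon. -/
noncomputable def blockAngle (n k j : ℕ) : ℝ := (2 * (j * k) + k - 1) * (π / n)

open Real in
lemma exists_abs_blockAngle_sub_le {n k j : ℕ} (hn : 0 < n) {i t : ℤ}
    (h : i + t * n ∈ Set.Icc (j * k : ℤ) (j * k + k - 1)) :
    |blockAngle n k j - 2 * i * π / n - 2 * π * t| ≤ (k - 1) * (π / n) := by
  have hn' : (0 : ℝ) < n := by exact_mod_cast hn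
  have e : blockAngle n k j - 2 * i * π / n - 2 * π * t =
      (2 * (j * k) + k - 1 - 2 * (i + t * n)) * (π / n) := by
    rw [blockAngle]; field_simp; ring
  rw [e, abs_mul, abs_of_pos (by positivity : 0 < π / n)]
  obtain ⟨h1, h2⟩ := h
  have h1' : (j * k : ℝ) ≤ i + t * n := by exact_mod_cast h1
  have h2' : (i + t * n : ℝ) ≤ j * k + k - 1 := by exact_mod_cast h2
  gcongr
  rw [abs_le]
  constructor <;> linarith

open Real Classical in
lemma le_card_filter_sin_lt_cos {m n N : ℕ} (hn : 3 ≤ n) (hN : m * n ≤ N * ((n - 1) / 2))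
    (i : ℕ) :
    m ≤ ((Finset.range N).filter fun j : ℕ =>
      sin (π / n) < cos (blockAngle n ((n - 1) / 2) j - 2 * i * π / n)).card := by
  refine (le_card_filter_exists_mem_Icc (by omega) (by omega) hN i).trans
    (Finset.card_le_card fun j hj => ?_)
  obtain ⟨hj, t, ht⟩ := Finset.mem_filter.1 hj
  refine Finset.mem_filter.2 ⟨hj, ?_⟩
  have hπ := pi_pos
  have hn0 : (0 : ℝ) < n := by exact_mod_cast (by omega : 0 < n)
  have h := exists_abs_blockAngle_sub_le (by omega) ht
  have hk : (2 : ℝ) * ((n - 1) / 2 : ℕ) ≤ n - 1 := by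
    have : 2 * ((n - 1) / 2) + 1 ≤ n := by omega
    have : (2 * ((n - 1) / 2 : ℕ) + 1 : ℝ) ≤ n := by exact_mod_cast this
    linarith
  have e : π / 2 - π / n = ((n - 2) / 2) * (π / n) := by field_simp
  rw [← cos_pi_div_two_sub]
  have hα0 : 0 < π / n := by positivity
  refine cos_lt_cos_of_abs_sub_lt (k := t) (by linarith) ?_
  refine lt_of_le_of_lt (by simpa using h) ?_
  rw [e]
  gcongr
  linarith

-- The vertex nearest to `ψ` is within `π / n`, and a block containing it has its midpoint within
-- `(k - 1) * (π / n)` of it, where `k = (n - 1) / 2`; the sum `k * (π / n)` is below `π / 2`.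
open Real Classical in
lemma le_card_filter_cos_pos {m n N : ℕ} (hn : 3 ≤ n) (hN : m * n ≤ N * ((n - 1) / 2))
    (ψ : ℝ) :
    m ≤ ((Finset.range N).filter fun j : ℕ =>
      0 < cos (blockAngle n ((n - 1) / 2) j - ψ)).card := by
  have hπ := pi_pos
  have hn0 : (0 : ℝ) < n := by exact_mod_cast (by omega : 0 < n)
  have hα0 : 0 < π / n := by positivity
  set i := round (ψ * n / (2 * π))
  refine (le_card_filter_exists_mem_Icc (by omega) (by omega) hN i).trans
    (Finset.card_le_card fun j hj => ?_)
  obtain ⟨hj, t, ht⟩ := Finset.mem_filter.1 hj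
  refine Finset.mem_filter.2 ⟨hj, ?_⟩
  have h := exists_abs_blockAngle_sub_le (by omega) ht
  have h' : |2 * i * π / n - ψ| ≤ π / n := by
    have h1 := abs_sub_round (ψ * n / (2 * π))
    rw [abs_sub_comm] at h1
    have e : 2 * i * π / n - ψ = (i - ψ * n / (2 * π)) * (2 * (π / n)) := by field_simp
    rw [e, abs_mul, abs_of_pos (by positivity : 0 < 2 * (π / n))]
    nlinarith
  have hk : (2 : ℝ) * ((n - 1) / 2 : ℕ) ≤ n - 1 := by
    have : 2 * ((n - 1) / 2) + 1 ≤ n := by omega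
    have : (2 * ((n - 1) / 2 : ℕ) + 1 : ℝ) ≤ n := by exact_mod_cast this
    linarith
  have e : π / 2 = (n / 2) * (π / n) := by field_simp
  rw [← cos_pi_div_two]
  refine cos_lt_cos_of_abs_sub_lt (k := t) (by linarith) ?_
  rw [e]
  rw [abs_le] at h h'
  rw [abs_lt]
  constructor <;> nlinarith [mul_le_mul_of_nonneg_right hk hα0.le]

/-! ### The bipyramid vertices and the cap body condition -/

lemma EuclideanSpace.norm_sq_fin_three (x : EuclideanSpace ℝ (Fin 3)) :
    ‖x‖ ^ 2 = x 0 ^ 2 + x 1 ^ 2 + x 2 ^ 2 := by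
  rw [EuclideanSpace.real_norm_sq_eq, Fin.sum_univ_three]

lemma EuclideanSpace.inner_fin_three (x y : EuclideanSpace ℝ (Fin 3)) :
    inner ℝ x y = x 0 * y 0 + x 1 * y 1 + x 2 * y 2 := by
  simp [PiLp.inner_apply, Fin.sum_univ_three]; ring

section Bipyramid

open Real

lemma cos_pi_div_pos {n : ℕ} (hn : 3 ≤ n) : 0 < cos (π / n) := by
  have hn' : (3 : ℝ) ≤ n := by exact_mod_cast hn
  have : π / n ≤ π / 3 := by gcongr
  have : 0 < π / n := by positivity
  exact cos_pos_of_mem_Ioo ⟨by linarith [pi_pos], by linarith [pi_pos]⟩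

lemma sin_pi_div_pos {n : ℕ} (hn : 3 ≤ n) : 0 < sin (π / n) := by
  have hn' : (3 : ℝ) ≤ n := by exact_mod_cast hn
  have : π / n ≤ π / 3 := by gcongr
  have : 0 < π / n := by positivity
  exact sin_pos_of_pos_of_lt_pi this (by linarith [pi_pos])

lemma secant_polar {n : ℕ} (hn : 3 ≤ n) :
    secant (((n : ℝ) - 2) * π / (2 * n)) = 1 / sin (π / n) := by
  have hn' : (0 : ℝ) < n := by exact_mod_cast (by omega : 0 < n)
  rw [secant, ← cos_pi_div_two_sub]
  congr 2
  field_simp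

lemma mem_bipyramidVertices {n : ℕ} (hn : 3 ≤ n) {v : EuclideanSpace ℝ (Fin 3)} :
    v ∈ bipyramidVertices n ↔ (∃ i ∈ Set.Icc 1 n, equatorialVertex n i = v) ∨
      v = !₂[0, 0, 1 / sin (π / n)] ∨ v = !₂[0, 0, -(1 / sin (π / n))] := by
  rw [bipyramidVertices, secant_polar hn, Set.mem_union, Set.mem_image, Set.mem_insert_iff,
    Set.mem_singleton_iff]

lemma norm_sq_equatorialVertex (n i : ℕ) :
    ‖equatorialVertex n i‖ ^ 2 = 1 / cos (π / n) ^ 2 := by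
  rw [EuclideanSpace.norm_sq_fin_three]
  simp only [equatorialVertex, secant, PiLp.toLp_apply, Matrix.cons_val]
  linear_combination 1 / cos (π / n) ^ 2 * sin_sq_add_cos_sq (2 * i * π / n)

lemma norm_sq_polar (h : ℝ) : ‖(!₂[0, 0, h] : EuclideanSpace ℝ (Fin 3))‖ ^ 2 = h ^ 2 := by
  simp [EuclideanSpace.norm_sq_fin_three]

lemma inner_equatorialVertex (n i : ℕ) (u : EuclideanSpace ℝ (Fin 3)) :
    inner ℝ u (equatorialVertex n i) =
      (u 0 * cos (2 * i * π / n) + u 1 * sin (2 * i * π / n)) / cos (π / n) := by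
  rw [EuclideanSpace.inner_fin_three]
  simp only [equatorialVertex, secant, PiLp.toLp_apply, Matrix.cons_val]
  ring

lemma inner_polar (h : ℝ) (u : EuclideanSpace ℝ (Fin 3)) :
    inner ℝ u (!₂[0, 0, h] : EuclideanSpace ℝ (Fin 3)) = u 2 * h := by
  simp [EuclideanSpace.inner_fin_three]

lemma one_lt_norm_of_mem_bipyramidVertices {n : ℕ} (hn : 3 ≤ n) {v : EuclideanSpace ℝ (Fin 3)}
    (hv : v ∈ bipyramidVertices n) : 1 < ‖v‖ := by
  have hc := cos_pi_div_pos hn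
  have hs := sin_pi_div_pos hn
  have h1 := sin_sq_add_cos_sq (π / n)
  have key : 1 < ‖v‖ ^ 2 := by
    rcases (mem_bipyramidVertices hn).1 hv with ⟨i, -, rfl⟩ | rfl | rfl
    · rw [norm_sq_equatorialVertex, one_lt_div (by positivity)]; nlinarith
    all_goals
      rw [norm_sq_polar]
      simp only [neg_sq, div_pow, one_pow]
      rw [one_lt_div (by positivity)]; nlinarith
  nlinarith [norm_nonneg v]

lemma abs_cos_sub_le {n i j : ℕ} (hi : i ∈ Set.Icc 1 n) (hj : j ∈ Set.Icc 1 n)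
    (hij : i < j) : |cos (j * (π / n) - i * (π / n))| ≤ cos (π / n) := by
  obtain ⟨hi1, hi2⟩ := hi
  obtain ⟨hj1, hj2⟩ := hj
  have hn : (0 : ℝ) < n := by exact_mod_cast (by omega : 0 < n)
  have h1 : (i : ℝ) + 1 ≤ j := by exact_mod_cast hij
  have h2 : (j : ℝ) + 1 ≤ n + i := by exact_mod_cast (by omega : j + 1 ≤ n + i)
  have hα : 0 < π / n := by positivity
  have hπ : π = n * (π / n) := by field_simp
  have ha : π / n ≤ j * (π / n) - i * (π / n) := by nlinarith
  have hb : j * (π / n) - i * (π / n) ≤ π - π / n := by nlinarith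
  rw [abs_le]
  constructor
  · rw [← cos_pi_sub]
    exact cos_le_cos_of_nonneg_of_le_pi (by linarith) (by linarith) hb
  · exact cos_le_cos_of_nonneg_of_le_pi hα.le (by linarith) ha

lemma segment_equatorialVertex_inter {n i j : ℕ} (hn : 3 ≤ n) (hi : i ∈ Set.Icc 1 n)
    (hj : j ∈ Set.Icc 1 n) (hij : i ≠ j) :
    (segment ℝ (equatorialVertex n i) (equatorialVertex n j) ∩
      Metric.closedBall 0 1).Nonempty := by
  wlog h : i < j generalizing i j
  · rw [segment_symm]
    exact this hj hi hij.symm (by omega)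
  have hc := cos_pi_div_pos hn
  -- The midpoint has norm `|cos ((j - i) * π / n)| / cos (π / n)`.
  refine ⟨(1 / 2 : ℝ) • equatorialVertex n i + (1 / 2 : ℝ) • equatorialVertex n j,
    ⟨1 / 2, 1 / 2, by norm_num, by norm_num, by norm_num, rfl⟩, ?_⟩
  rw [mem_closedBall_zero_iff]
  refine abs_le_one_iff_mul_self_le_one.2 ?_ |> (le_abs_self _).trans
  rw [← sq, norm_add_sq_real, norm_smul, norm_smul, mul_pow, mul_pow, norm_sq_equatorialVertex,
    norm_sq_equatorialVertex, real_inner_smul_left, real_inner_smul_right,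
    inner_equatorialVertex]
  simp only [equatorialVertex, secant, PiLp.toLp_apply, Matrix.cons_val]
  have h1 := cos_sub (2 * j * π / n) (2 * i * π / n)
  have h2 := cos_sq (j * (π / n) - i * (π / n))
  rw [show 2 * (j * (π / n) - i * (π / n)) = 2 * j * π / n - 2 * i * π / n by ring, h1] at h2
  have h3 := sq_le_sq' (abs_le.1 (abs_cos_sub_le hi hj h)).1 (abs_le.1 (abs_cos_sub_le hi hj h)).2
  rw [h2] at h3
  have e : ‖(1 / 2 : ℝ)‖ = 1 / 2 := by norm_num
  rw [e]
  calc _ = (1 / 2 + (cos (2 * j * π / n) * cos (2 * i * π / n) +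
          sin (2 * j * π / n) * sin (2 * i * π / n)) / 2) / cos (π / n) ^ 2 := by
        field_simp; ring
    _ ≤ 1 := (div_le_one (by positivity)).2 h3

lemma segment_equatorialVertex_polar_inter {n : ℕ} (hn : 3 ≤ n) (i : ℕ) {h : ℝ}
    (hh : h ^ 2 = 1 / sin (π / n) ^ 2) :
    (segment ℝ (equatorialVertex n i) !₂[0, 0, h] ∩ Metric.closedBall 0 1).Nonempty := by
  have hc := cos_pi_div_pos hn
  have hs := sin_pi_div_pos hn
  -- The two endpoints are orthogonal with squared norms `1 / cos ^ 2` and `1 / sin ^ 2`, so these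
  -- weights give the foot of the perpendicular from the origin, of norm exactly `1`.
  refine ⟨(cos (π / n) ^ 2) • equatorialVertex n i + (sin (π / n) ^ 2) • !₂[0, 0, h],
    ⟨_, _, sq_nonneg _, sq_nonneg _, cos_sq_add_sin_sq _, rfl⟩, ?_⟩
  rw [mem_closedBall_zero_iff]
  refine abs_le_one_iff_mul_self_le_one.2 ?_ |> (le_abs_self _).trans
  rw [← sq, norm_add_sq_real, norm_smul, norm_smul, mul_pow, mul_pow, norm_sq_equatorialVertex,
    norm_sq_polar, hh, real_inner_smul_left, real_inner_smul_right, inner_polar]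
  simp only [equatorialVertex, PiLp.toLp_apply, Matrix.cons_val, Real.norm_eq_abs, sq_abs]
  refine le_of_eq ?_
  field_simp
  linear_combination cos_sq_add_sin_sq (π / n)

lemma segment_polar_inter (h : ℝ) :
    (segment ℝ !₂[0, 0, h] !₂[0, 0, -h] ∩
      Metric.closedBall (0 : EuclideanSpace ℝ (Fin 3)) 1).Nonempty := by
  refine ⟨0, ⟨1 / 2, 1 / 2, by norm_num, by norm_num, by norm_num, ?_⟩, by simp⟩
  ext k
  fin_cases k <;> simp

lemma finite_bipyramidVertices (n : ℕ) : (bipyramidVertices n).Finite :=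
  ((Set.finite_Icc 1 n).image _).union (by simp)

lemma isCapBody_bipyramidVertices {n : ℕ} (hn : 3 ≤ n) :
    IsCapBody (Metric.closedBall 0 1) (bipyramidVertices n)
      (spikyBody (Metric.closedBall 0 1) (bipyramidVertices n)) := by
  refine ⟨(finite_bipyramidVertices n).countable, Set.disjoint_left.2 fun v hv => ?_, ?_, rfl⟩
  · simpa using one_lt_norm_of_mem_bipyramidVertices hn hv
  · have e1 : (1 / sin (π / n)) ^ 2 = 1 / sin (π / n) ^ 2 := by ring
    have e2 : (-(1 / sin (π / n))) ^ 2 = 1 / sin (π / n) ^ 2 := by ring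
    intro v hv w hw hvw
    rcases (mem_bipyramidVertices hn).1 hv with ⟨i, hi, rfl⟩ | rfl | rfl <;>
      rcases (mem_bipyramidVertices hn).1 hw with ⟨j, hj, rfl⟩ | rfl | rfl
    · exact segment_equatorialVertex_inter hn hi hj fun h => hvw (h ▸ rfl)
    · exact segment_equatorialVertex_polar_inter hn i e1
    · exact segment_equatorialVertex_polar_inter hn i e2
    · rw [segment_symm]; exact segment_equatorialVertex_polar_inter hn j e1
    · exact absurd rfl hvw
    · exact segment_polar_inter _
    · rw [segment_symm]; exact segment_equatorialVertex_polar_inter hn j e2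
    · rw [segment_symm]; exact segment_polar_inter _
    · exact absurd rfl hvw

end Bipyramid

/-! ### Lower bound: what one direction can illuminate -/

section BipyramidIllumination

open Real

lemma sqrt_one_div_sq_sub_one {a b : ℝ} (ha : 0 < a) (hb : 0 < b) (h : a ^ 2 + b ^ 2 = 1) :
    √(1 / a ^ 2 - 1) = b / a := by
  rw [← Real.sqrt_sq (by positivity : 0 ≤ b / a)]
  congr 1
  field_simp
  linarith

lemma sin_lt_of_illuminates_equatorialVertex {n i : ℕ} (hn : 3 ≤ n) (hi : i ∈ Set.Icc 1 n)
    {u : Metric.sphere (0 : EuclideanSpace ℝ (Fin 3)) 1}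
    (h : Illuminates (spikyBody (Metric.closedBall 0 1) (bipyramidVertices n)) u
      (equatorialVertex n i)) :
    sin (π / n) < -u.1 0 * cos (2 * i * π / n) + -u.1 1 * sin (2 * i * π / n) := by
  have hc := cos_pi_div_pos hn
  have h1 := (isCapBody_bipyramidVertices hn).lt_neg_inner_of_illuminates
    ((mem_bipyramidVertices hn).2 (Or.inl ⟨i, hi, rfl⟩)) h
  rw [norm_sq_equatorialVertex, sqrt_one_div_sq_sub_one hc (sin_pi_div_pos hn)
    (cos_sq_add_sin_sq _), inner_equatorialVertex, ← neg_div, div_lt_div_iff_of_pos_right hc] at h1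
  linarith

lemma cos_lt_of_illuminates_polar {n : ℕ} (hn : 3 ≤ n) {σ : ℝ} (hσ : σ = 1 ∨ σ = -1)
    {u : Metric.sphere (0 : EuclideanSpace ℝ (Fin 3)) 1}
    (h : Illuminates (spikyBody (Metric.closedBall 0 1) (bipyramidVertices n)) u
      !₂[0, 0, σ * (1 / sin (π / n))]) :
    cos (π / n) < -(σ * u.1 2) := by
  have hs := sin_pi_div_pos hn
  have hmem : !₂[0, 0, σ * (1 / sin (π / n))] ∈ bipyramidVertices n := by
    rw [mem_bipyramidVertices hn]
    rcases hσ with rfl | rfl <;> simp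
  have hσ2 : σ ^ 2 = 1 := by rcases hσ with rfl | rfl <;> norm_num
  have h1 := (isCapBody_bipyramidVertices hn).lt_neg_inner_of_illuminates hmem h
  rw [norm_sq_polar, mul_pow, hσ2, one_mul, div_pow, one_pow,
    sqrt_one_div_sq_sub_one hs (cos_pi_div_pos hn) (sin_sq_add_cos_sq _), inner_polar,
    mul_one_div, mul_div_assoc', ← neg_div, div_lt_div_iff_of_pos_right hs] at h1
  linarith

lemma sum_sq_eq_one (u : Metric.sphere (0 : EuclideanSpace ℝ (Fin 3)) 1) :
    u.1 0 ^ 2 + u.1 1 ^ 2 + u.1 2 ^ 2 = 1 := by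
  rw [← EuclideanSpace.norm_sq_fin_three]; simp

/-- Lighting both would force the polar component of `u` above `cos (π / n)` and the equatorial one
above `sin (π / n)` in size, so `‖u‖ > 1`. -/
lemma not_illuminates_equatorialVertex_of_polar {n i : ℕ} (hn : 3 ≤ n) (hi : i ∈ Set.Icc 1 n)
    {σ : ℝ} (hσ : σ = 1 ∨ σ = -1) {u : Metric.sphere (0 : EuclideanSpace ℝ (Fin 3)) 1}
    (h : Illuminates (spikyBody (Metric.closedBall 0 1) (bipyramidVertices n)) u
      !₂[0, 0, σ * (1 / sin (π / n))]) :
    ¬ Illuminates (spikyBody (Metric.closedBall 0 1) (bipyramidVertices n)) u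
      (equatorialVertex n i) := by
  intro h'
  have h1 := cos_lt_of_illuminates_polar hn hσ h
  have h2 := sin_lt_of_illuminates_equatorialVertex hn hi h'
  have hs := sin_pi_div_pos hn
  have hc := cos_pi_div_pos hn
  have hu := sum_sq_eq_one u
  have hz : cos (π / n) ^ 2 < u.1 2 ^ 2 := by
    have e : u.1 2 ^ 2 = (-(σ * u.1 2)) ^ 2 := by rcases hσ with rfl | rfl <;> ring
    rw [e]; gcongr
  have h3 : sin (π / n) ^ 2 < (-u.1 0 * cos (2 * i * π / n) + -u.1 1 * sin (2 * i * π / n)) ^ 2 := by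
    gcongr
  have h4 := sin_sq_add_cos_sq (π / n)
  have h5 := sin_sq_add_cos_sq (2 * i * π / n)
  have h6 : (-u.1 0 * cos (2 * i * π / n) + -u.1 1 * sin (2 * i * π / n)) ^ 2 +
      (u.1 0 * sin (2 * i * π / n) - u.1 1 * cos (2 * i * π / n)) ^ 2 =
      u.1 0 ^ 2 + u.1 1 ^ 2 := by
    linear_combination (u.1 0 ^ 2 + u.1 1 ^ 2) * h5
  nlinarith [sq_nonneg (u.1 0 * sin (2 * i * π / n) - u.1 1 * cos (2 * i * π / n))]

-- The weighted count for a single direction; summing it over `U` gives the lower bound.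
open Classical in
lemma card_illuminated_vertices_le {n : ℕ} (hn : 3 ≤ n)
    (u : Metric.sphere (0 : EuclideanSpace ℝ (Fin 3)) 1) :
    let K := spikyBody (Metric.closedBall 0 1) (bipyramidVertices n)
    (n - 1) / 2 * (if Illuminates K u !₂[0, 0, 1 * (1 / sin (π / n))] then 1 else 0) +
      (n - 1) / 2 * (if Illuminates K u !₂[0, 0, -1 * (1 / sin (π / n))] then 1 else 0) +
      ∑ i ∈ Finset.Icc 1 n, (if Illuminates K u (equatorialVertex n i) then 1 else 0) ≤
      (n - 1) / 2 := by
  intro K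
  have hzero : ∀ σ : ℝ, σ = 1 ∨ σ = -1 → Illuminates K u !₂[0, 0, σ * (1 / sin (π / n))] →
      ∑ i ∈ Finset.Icc 1 n, (if Illuminates K u (equatorialVertex n i) then 1 else 0) = 0 := by
    intro σ hσ h
    refine Finset.sum_eq_zero fun i hi => if_neg ?_
    exact not_illuminates_equatorialVertex_of_polar hn (by simpa using hi) hσ h
  by_cases hN : Illuminates K u !₂[0, 0, 1 * (1 / sin (π / n))]
  · have hS : ¬ Illuminates K u !₂[0, 0, -1 * (1 / sin (π / n))] := fun hS => by
      have h1 := cos_lt_of_illuminates_polar hn (Or.inl rfl) hN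
      have h2 := cos_lt_of_illuminates_polar hn (Or.inr rfl) hS
      linarith [cos_pi_div_pos hn]
    rw [hzero 1 (Or.inl rfl) hN, if_pos hN, if_neg hS]
    simp
  by_cases hS : Illuminates K u !₂[0, 0, -1 * (1 / sin (π / n))]
  · rw [hzero (-1) (Or.inr rfl) hS, if_neg hN, if_pos hS]
    simp
  rw [if_neg hN, if_neg hS, mul_zero, zero_add, zero_add, ← Finset.card_filter]
  refine le_trans (Finset.card_le_card fun i hi => ?_)
    (card_filter_sin_lt_le hn (x := -u.1 0) (y := -u.1 1) ?_)
  · rw [Finset.mem_filter] at hi ⊢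
    exact ⟨hi.1, sin_lt_of_illuminates_equatorialVertex hn (by simpa using hi.1) hi.2⟩
  · nlinarith [sum_sq_eq_one u, sq_nonneg (u.1 2)]

open Classical in
lemma le_mul_card_of_isMultiIlluminated {m n : ℕ} (hn : 3 ≤ n)
    {U : Multiset (Metric.sphere (0 : EuclideanSpace ℝ (Fin 3)) 1)}
    (hU : IsMultiIlluminated m (spikyBody (Metric.closedBall 0 1) (bipyramidVertices n)) U) :
    (n - 1) / 2 * m + (n - 1) / 2 * m + n * m ≤ (n - 1) / 2 * U.card := by
  set K := spikyBody (Metric.closedBall (0 : EuclideanSpace ℝ (Fin 3)) 1)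
    (bipyramidVertices n) with hK
  have hcap := isCapBody_bipyramidVertices hn
  have count : ∀ W : Multiset (Metric.sphere (0 : EuclideanSpace ℝ (Fin 3)) 1),
      (n - 1) / 2 * W.countP (fun u => Illuminates K u !₂[0, 0, 1 * (1 / sin (π / n))]) +
      (n - 1) / 2 * W.countP (fun u => Illuminates K u !₂[0, 0, -1 * (1 / sin (π / n))]) +
      ∑ i ∈ Finset.Icc 1 n, W.countP (fun u => Illuminates K u (equatorialVertex n i)) ≤
      (n - 1) / 2 * W.card := by
    intro W
    induction W using Multiset.induction_on with
    | empty => simp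
    | cons u W ih =>
      have h := card_illuminated_vertices_le hn u
      simp only [Multiset.countP_cons, Multiset.card_cons, Finset.sum_add_distrib, mul_add,
        mul_one]
      simp only at h
      linarith
  refine le_trans ?_ (count U)
  have hsum : n * m ≤
      ∑ i ∈ Finset.Icc 1 n, U.countP (fun u => Illuminates K u (equatorialVertex n i)) := by
    have := Finset.card_nsmul_le_sum (Finset.Icc 1 n)
      (fun i => U.countP (fun u => Illuminates K u (equatorialVertex n i))) m fun i hi =>
        hU _ (hcap.mem_frontier ((mem_bipyramidVertices hn).2
          (Or.inl ⟨i, by simpa using hi, rfl⟩)))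
    simpa using this
  gcongr
  · exact hU _ (hcap.mem_frontier ((mem_bipyramidVertices hn).2 (by simp)))
  · exact hU _ (hcap.mem_frontier ((mem_bipyramidVertices hn).2 (by simp)))

/-! ### Upper bound: the explicit directions -/

/-- The unit vector opposite to the point of the equator with the given argument. -/
noncomputable def equatorialDirection (φ : ℝ) :
    Metric.sphere (0 : EuclideanSpace ℝ (Fin 3)) 1 :=
  ⟨!₂[-cos φ, -sin φ, 0], by
    rw [mem_sphere_zero_iff_norm]
    simp [EuclideanSpace.norm_eq, Fin.sum_univ_three]⟩

/-- The unit vector along the polar axis with the given orientation. -/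
noncomputable def polarDirection (σ : ℤˣ) : Metric.sphere (0 : EuclideanSpace ℝ (Fin 3)) 1 :=
  ⟨!₂[0, 0, ((σ : ℤ) : ℝ)], by
    rw [mem_sphere_zero_iff_norm]
    rcases Int.units_eq_one_or σ with rfl | rfl <;>
      simp [EuclideanSpace.norm_eq, Fin.sum_univ_three]⟩

/-- `m` copies of each polar direction, and the directions opposite to the midpoints of `N`
consecutive blocks of `(n - 1) / 2` vertices of the `n`-gon. -/
noncomputable def bipyramidDirections (m n N : ℕ) :
    Multiset (Metric.sphere (0 : EuclideanSpace ℝ (Fin 3)) 1) :=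
  Multiset.replicate m (polarDirection 1) + Multiset.replicate m (polarDirection (-1)) +
    (Multiset.range N).map fun j => equatorialDirection (blockAngle n ((n - 1) / 2) j)

lemma card_bipyramidDirections (m n N : ℕ) : (bipyramidDirections m n N).card = 2 * m + N := by
  simp [bipyramidDirections, two_mul]

lemma le_countP_bipyramidDirections_of_polar {m n N : ℕ}
    {P : Metric.sphere (0 : EuclideanSpace ℝ (Fin 3)) 1 → Prop} [DecidablePred P] (σ : ℤˣ)
    (hP : P (polarDirection σ)) : m ≤ (bipyramidDirections m n N).countP P := by
  have h : Multiset.replicate m (polarDirection σ) ≤ bipyramidDirections m n N := by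
    rw [bipyramidDirections]
    refine le_trans ?_ (Multiset.le_add_right _ _)
    rcases Int.units_eq_one_or σ with rfl | rfl
    · exact Multiset.le_add_right _ _
    · exact Multiset.le_add_left _ _
  refine le_trans (le_of_eq ?_) (Multiset.countP_le_of_le P h)
  rw [Multiset.countP_eq_card.2 fun a ha => (Multiset.eq_of_mem_replicate ha).symm ▸ hP,
    Multiset.card_replicate]

open Classical in
lemma le_countP_bipyramidDirections_of_equatorial {m n N : ℕ}
    {P : Metric.sphere (0 : EuclideanSpace ℝ (Fin 3)) 1 → Prop} [DecidablePred P] {Q : ℕ → Prop}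
    (hQ : m ≤ ((Finset.range N).filter Q).card)
    (hP : ∀ j, Q j → P (equatorialDirection (blockAngle n ((n - 1) / 2) j))) :
    m ≤ (bipyramidDirections m n N).countP P := by
  refine hQ.trans (le_trans ?_ (Multiset.countP_le_of_le P (Multiset.le_add_left _ _)))
  rw [Multiset.countP_map]
  exact Multiset.card_le_card (Multiset.monotone_filter_right _ fun j => hP j)

lemma isMultiIlluminated_bipyramidDirections {m n N : ℕ} (hn : 3 ≤ n)
    (hN : m * n ≤ N * ((n - 1) / 2)) :
    IsMultiIlluminated m (spikyBody (Metric.closedBall 0 1) (bipyramidVertices n))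
      (bipyramidDirections m n N) := by
  classical
  have hc := cos_pi_div_pos hn
  have hs := sin_pi_div_pos hn
  refine isMultiIlluminated_spikyBody_closedBall (finite_bipyramidVertices n)
    ⟨_, (mem_bipyramidVertices hn).2 (Or.inr (Or.inl rfl))⟩ (fun p hp => ?_) (fun v hv => ?_)
  -- Off the equator one polar direction, with its `m` copies, suffices; only equatorial points need
  -- the block directions.
  · rcases lt_trichotomy (p 2) 0 with hz | hz | hz
    · refine le_countP_bipyramidDirections_of_polar 1 ?_
      simpa [EuclideanSpace.inner_fin_three, polarDirection] using hz
    · set ψ := Complex.arg ⟨p 0, p 1⟩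
      have h1 : p 0 ^ 2 + p 1 ^ 2 = 1 := by
        have := EuclideanSpace.norm_sq_fin_three p
        rw [hp, hz] at this; linarith
      have hρ : ‖(⟨p 0, p 1⟩ : ℂ)‖ = 1 := by
        rw [Complex.norm_def, Complex.normSq_mk, ← sq, ← sq, h1, Real.sqrt_one]
      have hx : cos ψ = p 0 := by
        simpa [hρ] using Complex.norm_mul_cos_arg ⟨p 0, p 1⟩
      have hy : sin ψ = p 1 := by
        simpa [hρ] using Complex.norm_mul_sin_arg ⟨p 0, p 1⟩
      refine le_countP_bipyramidDirections_of_equatorial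
        (le_card_filter_cos_pos hn hN ψ) fun j hj => ?_
      rw [cos_sub, hx, hy] at hj
      simp only [EuclideanSpace.inner_fin_three, equatorialDirection, Matrix.cons_val]
      linarith
    · refine le_countP_bipyramidDirections_of_polar (-1) ?_
      simpa [EuclideanSpace.inner_fin_three, polarDirection] using hz
  · rcases (mem_bipyramidVertices hn).1 hv with ⟨i, -, rfl⟩ | rfl | rfl
    · refine le_countP_bipyramidDirections_of_equatorial
        (le_card_filter_sin_lt_cos hn hN i) fun j hj => ?_
      have e : inner ℝ (equatorialDirection (blockAngle n ((n - 1) / 2) j)).1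
          (equatorialVertex n i) =
          -(cos (blockAngle n ((n - 1) / 2) j - 2 * i * π / n) / cos (π / n)) := by
        rw [inner_equatorialVertex, cos_sub]
        simp only [equatorialDirection, PiLp.toLp_apply, Matrix.cons_val]
        ring
      rw [e, norm_sq_equatorialVertex]
      refine ⟨neg_lt_zero.2 (div_pos (hs.trans hj) hc), ?_⟩
      rw [neg_sq, div_pow, sub_lt_iff_lt_add, ← sub_lt_iff_lt_add', ← sub_pos]
      have h2 : sin (π / n) ^ 2 < cos (blockAngle n ((n - 1) / 2) j - 2 * i * π / n) ^ 2 := by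
        gcongr
      have h3 := sin_sq_add_cos_sq (π / n)
      have e2 : 1 - (1 / cos (π / n) ^ 2 -
          cos (blockAngle n ((n - 1) / 2) j - 2 * i * π / n) ^ 2 / cos (π / n) ^ 2) =
          (cos (blockAngle n ((n - 1) / 2) j - 2 * i * π / n) ^ 2 - sin (π / n) ^ 2) /
            cos (π / n) ^ 2 := by
        field_simp
        linarith
      rw [e2]
      exact div_pos (sub_pos.2 h2) (by positivity)
    · refine le_countP_bipyramidDirections_of_polar (-1) ?_
      rw [inner_polar, norm_sq_polar]
      simp [polarDirection, hs]
    · refine le_countP_bipyramidDirections_of_polar 1 ?_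
      rw [inner_polar, norm_sq_polar]
      simp [polarDirection, hs]

end BipyramidIllumination

theorem mainTheorem11 (m n : ℕ) (hm : 1 ≤ m) (hn : 3 ≤ n) :
    IsCapBody (Metric.closedBall (0 : EuclideanSpace ℝ (Fin 3)) 1) (bipyramidVertices n)
        (spikyBody (Metric.closedBall 0 1) (bipyramidVertices n)) ∧
      illuminationNumber m
          (spikyBody (Metric.closedBall (0 : EuclideanSpace ℝ (Fin 3)) 1) (bipyramidVertices n)) =
        ((2 * m + ⌈((m : ℝ) * n) / (⌊((n : ℝ) - 1) / 2⌋₊ : ℝ)⌉₊ : ℕ) : ℕ∞) := by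
  refine ⟨isCapBody_bipyramidVertices hn, ?_⟩
  have hfloor : ⌊((n : ℝ) - 1) / 2⌋₊ = (n - 1) / 2 := by
    have e : ((n : ℝ) - 1) / 2 = ((n - 1 : ℕ) : ℝ) / (2 : ℕ) := by
      rw [Nat.cast_sub (by omega)]; norm_num
    rw [e, Nat.floor_div_eq_div]
  have hk : (0 : ℝ) < ((n - 1) / 2 : ℕ) := by exact_mod_cast (by omega : 0 < (n - 1) / 2)
  rw [hfloor]
  refine le_antisymm ?_ (le_iInf₂ fun U hU => ?_)
  · refine (iInf₂_le _ (isMultiIlluminated_bipyramidDirections hn (N := _) ?_)).trans_eq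
      (congrArg Nat.cast (card_bipyramidDirections m n _))
    have := (div_le_iff₀ hk).1 (Nat.le_ceil (((m : ℝ) * n) / ((n - 1) / 2 : ℕ)))
    exact_mod_cast this
  · have h := le_mul_card_of_isMultiIlluminated hn hU
    have hk' : 0 < (n - 1) / 2 := by omega
    -- Needed so that the natural subtraction `U.card - 2 * m` below is not truncated.
    have h2 : 2 * m ≤ U.card := by
      refine le_of_mul_le_mul_left ?_ hk'
      nlinarith
    have h3 : ⌈((m : ℝ) * n) / ((n - 1) / 2 : ℕ)⌉₊ ≤ U.card - 2 * m := by
      rw [Nat.ceil_le, div_le_iff₀ hk]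
      have : m * n ≤ (U.card - 2 * m) * ((n - 1) / 2) := by
        obtain ⟨c, hc⟩ := Nat.exists_eq_add_of_le h2
        rw [hc] at h ⊢
        rw [Nat.add_sub_cancel_left]
        nlinarith
      exact_mod_cast this
    exact_mod_cast (by omega : 2 * m + ⌈((m : ℝ) * n) / ((n - 1) / 2 : ℕ)⌉₊ ≤ U.card)
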